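/- A permutation $p=p_1p_2\cdots p_n$ of $\{1,\dots,n\}$ contains an occurrence of a pattern $q=q_1\cdots q_k$ (a permutation of $\{1,\dots,k\}$) at positions $i_1<\cdots<i_k$ if $p_{i_1},\dots,p_{i_k}$ are in the same relative order as $q_1,\dots,q_k$; it avoids $q$ if it contains no occurrence of $q$. For $n\ge 0$ let $\mathrm{Av}_n(123)$ be the set of permutations of $\{1,\dots,n\}$ avoiding $123$, and let $a_n$ be the total number of occurrences of the pattern $213$ in all the permutations in $\mathrm{Av}_n(123)$. Let $C(x)=\sum_{n\ge 0}\frac{1}{n+1}\binom{2n}{n}x^n$ be the generating function of the Catalan numbers. Then, as formal power series over $\mathbb{Q}$, $$\sum_{n\ge 0}a_nx^n=\frac{x^3C(x)^3}{(1-4x)^{3/2}}=\frac{x-1}{2(1-4x)}-\frac{3x-1}{2(1-4x)^{3/2}},$$ where $(1-4x)^{3/2}=\sum_{n\ge 0}\binom{3/2}{n}(-4x)^n$. -/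

import Mathlib

open PowerSeries

/-- An occurrence of the pattern `q` in the permutation `p`: an increasing choice of positions
`f 0 < f 1 < ⋯ < f (k - 1)` whose entries in `p` are in the same relative order as the
entries of `q`. Permutations are read in one-line notation `p 0, p 1, …`, with letters
`0, …, n - 1` in place of `1, …, n`. -/
def IsOccurrence {k n : ℕ} (q : Equiv.Perm (Fin k)) (p : Equiv.Perm (Fin n))
    (f : Fin k → Fin n) : Prop :=
  (∀ i j, i < j → f i < f j) ∧ ∀ i j, p (f i) < p (f j) ↔ q i < q j

instance {k n : ℕ} (q : Equiv.Perm (Fin k)) (p : Equiv.Perm (Fin n)) :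
    DecidablePred (IsOccurrence q p) := fun f => by
  unfold IsOccurrence
  infer_instance

/-- The number of occurrences of the pattern `q` in the permutation `p`. -/
def numOcc {k n : ℕ} (q : Equiv.Perm (Fin k)) (p : Equiv.Perm (Fin n)) : ℕ :=
  (Finset.univ.filter (IsOccurrence q p)).card

/-- The `n`-permutations that avoid the pattern `q`. -/
def Av {k : ℕ} (n : ℕ) (q : Equiv.Perm (Fin k)) : Finset (Equiv.Perm (Fin n)) :=
  Finset.univ.filter fun p => ∀ f, ¬ IsOccurrence q p f

/-- The total number of occurrences of `q` in a finite set of `n`-permutations. -/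
def totalOcc {k n : ℕ} (q : Equiv.Perm (Fin k)) (S : Finset (Equiv.Perm (Fin n))) : ℕ :=
  ∑ p ∈ S, numOcc q p

/-- The pattern `123`, the identity. -/
def pat123 : Equiv.Perm (Fin 3) := 1

/-- The pattern `213`, which exchanges the first two letters. -/
def pat213 : Equiv.Perm (Fin 3) := Equiv.swap 0 1

/-- The Catalan generating function `C(x) = ∑ cₙ xⁿ` over `ℚ`. -/
noncomputable def catalanGF : ℚ⟦X⟧ := PowerSeries.mk fun n => (catalan n : ℚ)

/-- The formal power series `(1 - 4x)^r = ∑ binom(r, n) (-4x)ⁿ`, for a rational exponent `r`. -/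
noncomputable def oneSubFourXPow (r : ℚ) : ℚ⟦X⟧ :=
  PowerSeries.rescale (-4 : ℚ) (PowerSeries.binomialSeries ℚ r)

/-!
Put a new first entry with `i` larger ones in front of a `123`-avoider `p`. No `123` appears exactly
when the `i` largest entries of `p` are decreasing; and if `i > 0`, then in the new permutation the
`m` largest entries are decreasing only for `m ≤ i`. So refine the count by the number `m` of
largest entries required to be decreasing. The new occurrences of `213` are the pairs `a < c` of
positions of `p` with only the entry at `c` among the `i` largest, and such pairs can in turn be
counted by the same insertion.

The generating functions `fₘ` of the avoiders and of the occurrences of `213` satisfy recurrences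
`fₘ₊₁ - fₘ₊₂ - X fₘ = bₘ`. These are solved by the kernel method: the operator on the left splits
into two first-order factors with coefficients in terms of the Catalan series `C`, and a first-order
recurrence has at most one solution because `Xᵐ` divides `fₘ`. The occurrences of `213` lead to the
series `∑ binom(m + 2, 2) (X C²)ᵐ = (1 - X C²)⁻³`, and `1 - X C² = C √(1 - 4X)`.
-/

/-- The positions of the `m` largest entries of `p` (of all entries, if `n < m`). -/
def topPositions {n : ℕ} (m : ℕ) (p : Equiv.Perm (Fin n)) : Finset (Fin n) :=
  {a | n ≤ (p a : ℕ) + m}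

/-- The `m` largest entries of `p` appear in decreasing order. These permutations are exactly the
ones in front of which a new entry with `m` larger ones creates no `123`. -/
def TopDecreasing {n : ℕ} (m : ℕ) (p : Equiv.Perm (Fin n)) : Prop :=
  StrictAntiOn p (topPositions m p)

/-- The number of pairs of positions `a < c` such that the entry at `c` is among the `j` largest
entries of `p` while the entry at `a` is not. These are the occurrences of `213` that a new first
entry with `j` larger ones creates. -/
def crossPairs {n : ℕ} (j : ℕ) (p : Equiv.Perm (Fin n)) : ℕ :=
  ∑ a, ∑ c, if a < c ∧ a ∉ topPositions j p ∧ c ∈ topPositions j p then 1 else 0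

/-- The permutation obtained from `p` by putting a new first entry in front of it, with exactly
`i` larger entries; meaningful only for `i ≤ n`. -/
def frontInsert {n : ℕ} (i : ℕ) (p : Equiv.Perm (Fin n)) : Equiv.Perm (Fin (n + 1)) :=
  ((finSuccEquiv n).trans p.optionCongr).trans
    (finSuccEquiv' (⟨n - i, by omega⟩ : Fin (n + 1))).symm

section Occurrences

lemma isOccurrence_iff_strictMono {k n : ℕ} {q : Equiv.Perm (Fin k)} {p : Equiv.Perm (Fin n)}
    {f : Fin k → Fin n} :
    IsOccurrence q p f ↔ StrictMono f ∧ StrictMono fun x => p (f (q.symm x)) := by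
  refine and_congr (forall₂_congr fun _ _ => Iff.rfl) ⟨fun h i j hij => ?_, fun h i j => ?_⟩
  · simpa [h] using hij
  · simpa using h.lt_iff_lt (a := q i) (b := q j)

lemma strictMono_fin_three_iff {α : Type*} [Preorder α] {f : Fin 3 → α} :
    StrictMono f ↔ f 0 < f 1 ∧ f 1 < f 2 := by
  simp [Fin.strictMono_iff_lt_succ, Fin.forall_fin_two]

lemma isOccurrence_pat123_iff {n : ℕ} {p : Equiv.Perm (Fin n)} {f : Fin 3 → Fin n} :
    IsOccurrence pat123 p f ↔ f 0 < f 1 ∧ f 1 < f 2 ∧ p (f 0) < p (f 1) ∧ p (f 1) < p (f 2) := by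
  simp [isOccurrence_iff_strictMono, strictMono_fin_three_iff, pat123, and_assoc,
    ← Equiv.Perm.inv_def]

lemma isOccurrence_pat213_iff {n : ℕ} {p : Equiv.Perm (Fin n)} {f : Fin 3 → Fin n} :
    IsOccurrence pat213 p f ↔ f 0 < f 1 ∧ f 1 < f 2 ∧ p (f 1) < p (f 0) ∧ p (f 0) < p (f 2) := by
  simp [isOccurrence_iff_strictMono, strictMono_fin_three_iff, pat213, and_assoc,
    Equiv.swap_apply_of_ne_of_ne]

lemma sum_pi_fin_three {α M : Type*} [Fintype α] [AddCommMonoid M] (g : (Fin 3 → α) → M) :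
    ∑ f, g f = ∑ a, ∑ b, ∑ c, g ![a, b, c] := by
  simp only [← (Fin.consEquiv fun _ => α).sum_comp, Fintype.sum_prod_type, Fintype.sum_unique]
  rfl

lemma mem_Av_pat123 {n : ℕ} {p : Equiv.Perm (Fin n)} :
    p ∈ Av n pat123 ↔ ∀ a b c, a < b → b < c → p a < p b → ¬ p b < p c := by
  simp only [Av, Finset.mem_filter_univ, isOccurrence_pat123_iff]
  exact ⟨fun h a b c hab hbc pab pbc => h ![a, b, c] ⟨hab, hbc, pab, pbc⟩,
    fun h f ⟨hab, hbc, pab, pbc⟩ => h _ _ _ hab hbc pab pbc⟩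

lemma numOcc_pat213 {n : ℕ} (p : Equiv.Perm (Fin n)) :
    numOcc pat213 p =
      ∑ a, ∑ b, ∑ c, if a < b ∧ b < c ∧ p b < p a ∧ p a < p c then 1 else 0 := by
  simp only [numOcc, Finset.card_filter, sum_pi_fin_three, isOccurrence_pat213_iff]
  rfl

end Occurrences

section FrontInsert

variable {n i j m : ℕ} {p : Equiv.Perm (Fin n)}

lemma frontInsert_zero : frontInsert i p 0 = ⟨n - i, by omega⟩ := by
  simp [frontInsert]

lemma frontInsert_succ (a : Fin n) :
    frontInsert i p a.succ = (⟨n - i, by omega⟩ : Fin (n + 1)).succAbove (p a) := by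
  simp [frontInsert]

lemma frontInsert_succ_lt_succ {a b : Fin n} :
    frontInsert i p a.succ < frontInsert i p b.succ ↔ p a < p b := by
  simp only [frontInsert_succ, Fin.succAbove_lt_succAbove_iff]

lemma frontInsert_bijective (n : ℕ) :
    Function.Bijective fun x : Fin (n + 1) × Equiv.Perm (Fin n) => frontInsert x.1 x.2 := by
  rw [Fintype.bijective_iff_injective_and_card]
  refine ⟨?_, by simp [Fintype.card_perm, Nat.factorial_succ]⟩
  rintro ⟨i, p⟩ ⟨j, q⟩ h
  replace h := DFunLike.congr_fun h
  have first := h 0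
  simp only [frontInsert_zero, Fin.mk.injEq] at first
  obtain rfl : i = j := by omega
  have rest : p = q := Equiv.ext fun a => by simpa [frontInsert_succ] using h a.succ
  rw [rest]

lemma sum_perm_fin_succ {M : Type*} [AddCommMonoid M] (g : Equiv.Perm (Fin (n + 1)) → M) :
    ∑ q, g q = ∑ i ∈ Finset.range (n + 1), ∑ p : Equiv.Perm (Fin n), g (frontInsert i p) := by
  rw [Finset.sum_range fun i => ∑ p : Equiv.Perm (Fin n), g (frontInsert i p),
    ← Fintype.sum_prod_type']
  exact ((frontInsert_bijective n).sum_comp g).symm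

lemma mem_topPositions {a : Fin n} : a ∈ topPositions m p ↔ n ≤ (p a : ℕ) + m := by
  simp [topPositions]

lemma topPositions_zero (p : Equiv.Perm (Fin n)) : topPositions 0 p = ∅ := by
  ext a
  simp [mem_topPositions]

lemma mem_topPositions_of_lt {a b : Fin n} (ha : a ∈ topPositions m p) (hab : p a < p b) :
    b ∈ topPositions m p := by
  rw [mem_topPositions] at *
  rw [Fin.lt_def] at hab
  omega

lemma card_topPositions (hm : m ≤ n) (p : Equiv.Perm (Fin n)) : (topPositions m p).card = m := by
  have top_entries :
      (topPositions m p).map (p.toEmbedding.trans Fin.valEmbedding) = Finset.Ico (n - m) n := by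
    ext x
    simp only [Finset.mem_map, mem_topPositions, Function.Embedding.trans_apply,
      Equiv.coe_toEmbedding, Fin.valEmbedding_apply, Finset.mem_Ico]
    refine ⟨by rintro ⟨a, ha, rfl⟩; omega, fun hx => ⟨p.symm ⟨x, hx.2⟩, ?_, ?_⟩⟩ <;>
      simp only [Equiv.apply_symm_apply]
    omega
  rw [← Finset.card_map, top_entries, Nat.card_Ico]
  omega

lemma frontInsert_zero_lt_succ (hi : i ≤ n) {a : Fin n} :
    frontInsert i p 0 < frontInsert i p a.succ ↔ a ∈ topPositions i p := by
  rw [frontInsert_zero, frontInsert_succ, Fin.lt_succAbove_iff_le_castSucc, mem_topPositions,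
    Fin.le_def, Fin.val_castSucc, Fin.val_mk]
  omega

lemma frontInsert_succ_lt_zero (hi : i ≤ n) {a : Fin n} :
    frontInsert i p a.succ < frontInsert i p 0 ↔ a ∉ topPositions i p := by
  rw [← frontInsert_zero_lt_succ hi, not_lt, le_iff_lt_or_eq, EmbeddingLike.apply_eq_iff_eq]
  simp

lemma zero_mem_topPositions_frontInsert (hi : i ≤ n) :
    0 ∈ topPositions m (frontInsert i p) ↔ i < m := by
  rw [mem_topPositions, frontInsert_zero]
  grind

lemma succ_mem_topPositions_frontInsert (hi : i ≤ n) (hj : j ≤ i) {a : Fin n} :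
    a.succ ∈ topPositions j (frontInsert i p) ↔ a ∈ topPositions j p := by
  rw [mem_topPositions, mem_topPositions, frontInsert_succ, Fin.succAbove]
  simp only [Fin.lt_def, Fin.val_castSucc]
  split_ifs <;> simp only [Fin.val_succ, Fin.val_castSucc] <;> omega

lemma succ_mem_topPositions_frontInsert_zero {a : Fin n} :
    a.succ ∈ topPositions (m + 1) (frontInsert 0 p) ↔ a ∈ topPositions m p := by
  rw [mem_topPositions, mem_topPositions, frontInsert_succ, Fin.succAbove]
  simp only [Fin.lt_def, Fin.val_castSucc]
  split_ifs <;> simp only [Fin.val_succ, Fin.val_castSucc] <;> omega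

lemma frontInsert_mem_Av_pat123 (hi : i ≤ n) :
    frontInsert i p ∈ Av (n + 1) pat123 ↔ p ∈ Av n pat123 ∧ TopDecreasing i p := by
  have avoidsFrom_zero : (∀ b c, b < c → b ∈ topPositions i p → ¬ p b < p c) ↔
      TopDecreasing i p := by
    refine ⟨fun h b hb c _ hbc => ?_, fun h b c hbc hb pbc => ?_⟩
    · exact (not_lt.1 (h b c hbc hb)).lt_of_ne (p.injective.ne hbc.ne')
    · exact pbc.not_gt (h hb (mem_topPositions_of_lt hb pbc) hbc)
  rw [mem_Av_pat123, mem_Av_pat123, ← avoidsFrom_zero]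
  simp only [Fin.forall_fin_succ (n := n), frontInsert_succ_lt_succ, frontInsert_zero_lt_succ hi,
    Fin.succ_lt_succ_iff, Fin.succ_pos, Fin.not_lt_zero]
  simp [and_comm]

lemma topDecreasing_zero (p : Equiv.Perm (Fin n)) : TopDecreasing 0 p := by
  simp [TopDecreasing, topPositions_zero, StrictAntiOn]

lemma topDecreasing_one (p : Equiv.Perm (Fin n)) : TopDecreasing 1 p := by
  intro a ha b hb hab
  rw [Finset.mem_coe, mem_topPositions] at ha hb
  have := p.injective.ne hab.ne
  omega

lemma topDecreasing_frontInsert_zero :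
    TopDecreasing (m + 1) (frontInsert 0 p) ↔ TopDecreasing m p := by
  simp [TopDecreasing, StrictAntiOn, Fin.forall_fin_succ (n := n), frontInsert_succ_lt_succ,
    frontInsert_succ_lt_zero, succ_mem_topPositions_frontInsert_zero, topPositions_zero]

lemma topDecreasing_frontInsert_of_le (hi : i ≤ n) (hmi : m ≤ i) :
    TopDecreasing m (frontInsert i p) ↔ TopDecreasing m p := by
  simp [TopDecreasing, StrictAntiOn, Fin.forall_fin_succ (n := n), frontInsert_succ_lt_succ,
    zero_mem_topPositions_frontInsert hi, succ_mem_topPositions_frontInsert hi hmi, hmi.not_gt]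

lemma TopDecreasing.mono (hp : TopDecreasing i p) (hmi : m ≤ i) : TopDecreasing m p :=
  StrictAntiOn.mono hp fun a ha => by
    rw [Finset.mem_coe, mem_topPositions] at *
    omega

lemma not_topDecreasing_frontInsert_of_lt (hi : i ≤ n) (hi_pos : 0 < i) (him : i < m) :
    ¬ TopDecreasing m (frontInsert i p) := by
  intro h
  obtain ⟨c, hc⟩ : (topPositions i p).Nonempty := by
    rwa [← Finset.card_pos, card_topPositions hi]
  have hlt := (frontInsert_zero_lt_succ hi).2 hc
  have h0 := (zero_mem_topPositions_frontInsert (p := p) hi).2 him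
  exact hlt.not_gt (h h0 (mem_topPositions_of_lt h0 hlt) c.succ_pos)

lemma crossPairs_frontInsert (hi : i ≤ n) (hj : j ≤ i) :
    crossPairs j (frontInsert i p) = crossPairs j p + j := by
  have pairs_with_zero : (∑ c, if c ∈ topPositions j p then 1 else 0) = j := by
    rw [← Finset.card_filter, Finset.filter_univ_mem, card_topPositions (hj.trans hi)]
  simp [-Finset.sum_boole, crossPairs, Fin.sum_univ_succ (n := n), hj.not_gt, pairs_with_zero,
    zero_mem_topPositions_frontInsert hi, succ_mem_topPositions_frontInsert hi hj, add_comm]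

lemma crossPairs_zero (p : Equiv.Perm (Fin n)) : crossPairs 0 p = 0 := by
  simp [crossPairs, topPositions_zero]

lemma crossPairs_frontInsert_zero :
    crossPairs (j + 1) (frontInsert 0 p) = crossPairs j p := by
  simp [-Finset.sum_boole, crossPairs, Fin.sum_univ_succ (n := n),
    zero_mem_topPositions_frontInsert, succ_mem_topPositions_frontInsert_zero]

lemma numOcc_pat213_frontInsert (hi : i ≤ n) :
    numOcc pat213 (frontInsert i p) = numOcc pat213 p + crossPairs i p := by
  simp [-Finset.sum_boole, numOcc_pat213, crossPairs, Fin.sum_univ_succ (n := n),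
    frontInsert_succ_lt_succ, frontInsert_zero_lt_succ hi, frontInsert_succ_lt_zero hi, add_comm]

end FrontInsert

open Classical in
/-- The `n`-permutations avoiding `123` whose `m` largest entries appear in decreasing order; there
are none if `n < m`. -/
noncomputable def topDecreasingAv (n m : ℕ) : Finset (Equiv.Perm (Fin n)) :=
  {p ∈ Av n pat123 | m ≤ n ∧ TopDecreasing m p}

/-- The generating function `∑ₙ xⁿ ∑ₚ φₙ(p)` of a statistic `φ`, where `p` runs over the
`n`-permutations in `topDecreasingAv n m`. -/
noncomputable def statGF (m : ℕ) (φ : ∀ n, Equiv.Perm (Fin n) → ℚ) : ℚ⟦X⟧ :=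
  PowerSeries.mk fun n => ∑ p ∈ topDecreasingAv n m, φ n p

section Recurrences

variable {n m : ℕ}

lemma mem_topDecreasingAv {p : Equiv.Perm (Fin n)} :
    p ∈ topDecreasingAv n m ↔ p ∈ Av n pat123 ∧ m ≤ n ∧ TopDecreasing m p := by
  simp [topDecreasingAv]

lemma topDecreasingAv_of_lt (h : n < m) : topDecreasingAv n m = ∅ := by
  ext p
  simp [mem_topDecreasingAv, h.not_ge]

lemma topDecreasingAv_zero (n : ℕ) : topDecreasingAv n 0 = Av n pat123 := by
  ext p
  simp [mem_topDecreasingAv, topDecreasing_zero]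

lemma topDecreasingAv_succ_one (n : ℕ) : topDecreasingAv (n + 1) 1 = Av (n + 1) pat123 := by
  ext p
  simp [mem_topDecreasingAv, topDecreasing_one]

lemma frontInsert_zero_mem_topDecreasingAv {p : Equiv.Perm (Fin n)} :
    frontInsert 0 p ∈ topDecreasingAv (n + 1) (m + 1) ↔ p ∈ topDecreasingAv n m := by
  simp [mem_topDecreasingAv, frontInsert_mem_Av_pat123, topDecreasing_zero,
    topDecreasing_frontInsert_zero]

lemma frontInsert_mem_topDecreasingAv {i : ℕ} (hi : i ≤ n) (hi_pos : 0 < i)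
    {p : Equiv.Perm (Fin n)} :
    frontInsert i p ∈ topDecreasingAv (n + 1) m ↔ m ≤ i ∧ p ∈ topDecreasingAv n i := by
  rw [mem_topDecreasingAv, mem_topDecreasingAv, frontInsert_mem_Av_pat123 hi]
  rcases le_or_gt m i with hmi | him
  · have := fun hp : TopDecreasing i p => hp.mono hmi
    rw [topDecreasing_frontInsert_of_le hi hmi]
    grind
  · simp [not_topDecreasing_frontInsert_of_lt hi hi_pos him, him.not_ge]

lemma sum_topDecreasingAv_succ {M : Type*} [AddCommMonoid M] (φ : Equiv.Perm (Fin (n + 1)) → M) :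
    ∑ p ∈ topDecreasingAv (n + 1) (m + 1), φ p =
      ∑ p ∈ topDecreasingAv n m, φ (frontInsert 0 p) +
        ∑ i ∈ Finset.Ico (m + 1) (n + 1), ∑ p ∈ topDecreasingAv n i, φ (frontInsert i p) := by
  classical
  have sum_ite (k l) (ψ : Equiv.Perm (Fin k) → M) :
      ∑ p ∈ topDecreasingAv k l, ψ p = ∑ p, if p ∈ topDecreasingAv k l then ψ p else 0 := by simp
  rw [sum_ite, sum_perm_fin_succ, Finset.range_eq_Ico, Finset.sum_eq_sum_Ico_succ_bot n.succ_pos]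
  simp only [frontInsert_zero_mem_topDecreasingAv, ← sum_ite]
  congr 1
  have : Finset.Ico (m + 1) (n + 1) = {i ∈ Finset.Ico 1 (n + 1) | m + 1 ≤ i} := by grind
  rw [this, Finset.sum_filter]
  refine Finset.sum_congr rfl fun i hi => ?_
  rw [Finset.mem_Ico] at hi
  simp only [frontInsert_mem_topDecreasingAv (Nat.le_of_lt_succ hi.2) hi.1]
  split_ifs with h <;> simp [h]

lemma sum_topDecreasingAv_succ_sub {M : Type*} [AddCommGroup M]
    (φ : Equiv.Perm (Fin (n + 1)) → M) :
    ∑ p ∈ topDecreasingAv (n + 1) (m + 1), φ p - ∑ p ∈ topDecreasingAv (n + 1) (m + 2), φ p =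
      ∑ p ∈ topDecreasingAv n m, φ (frontInsert 0 p) -
        ∑ p ∈ topDecreasingAv n (m + 1), φ (frontInsert 0 p) +
        ∑ p ∈ topDecreasingAv n (m + 1), φ (frontInsert (m + 1) p) := by
  rw [sum_topDecreasingAv_succ, sum_topDecreasingAv_succ]
  rcases lt_or_ge n (m + 1) with h | h
  · simp [topDecreasingAv_of_lt h, Finset.Ico_eq_empty_of_le, (Nat.succ_le_of_lt h).trans]
  · rw [Finset.sum_eq_sum_Ico_succ_bot (by omega : m + 1 < n + 1)]
    abel

lemma X_pow_dvd_statGF (m : ℕ) (φ : ∀ n, Equiv.Perm (Fin n) → ℚ) : X ^ m ∣ statGF m φ := by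
  rw [X_pow_dvd_iff]
  intro n hn
  simp [statGF, topDecreasingAv_of_lt hn]

lemma statGF_congr {φ ψ : ∀ n, Equiv.Perm (Fin n) → ℚ}
    (h : ∀ n, ∀ p ∈ topDecreasingAv n m, φ n p = ψ n p) :
    statGF m φ = statGF m ψ := by
  ext n
  simpa [statGF] using Finset.sum_congr rfl (h n)

lemma statGF_add (φ ψ : ∀ n, Equiv.Perm (Fin n) → ℚ) :
    statGF m (φ + ψ) = statGF m φ + statGF m ψ := by
  ext n
  simp [statGF, Finset.sum_add_distrib]

lemma statGF_natCast (k : ℕ) : statGF m (fun _ _ => k) = k * statGF m 1 := by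
  ext n
  rw [← nsmul_eq_mul, map_nsmul, nsmul_eq_mul]
  simp only [statGF, coeff_mk, Finset.sum_const, Pi.one_apply, nsmul_eq_mul, mul_one]
  exact mul_comm _ _

lemma statGF_zero (φ : ∀ n, Equiv.Perm (Fin n) → ℚ) :
    statGF 0 φ = statGF 1 φ + PowerSeries.C (φ 0 1) := by
  ext n
  cases n with
  | zero =>
    have : Av 0 pat123 = {1} := by decide
    simp [statGF, topDecreasingAv_zero, topDecreasingAv_of_lt, this]
  | succ n => simp [statGF, topDecreasingAv_zero, topDecreasingAv_succ_one]

lemma statGF_succ_sub (m : ℕ) (φ : ∀ n, Equiv.Perm (Fin n) → ℚ) :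
    statGF (m + 1) φ - statGF (m + 2) φ =
      X * (statGF m (fun n p => φ (n + 1) (frontInsert 0 p)) -
        statGF (m + 1) (fun n p => φ (n + 1) (frontInsert 0 p)) +
        statGF (m + 1) (fun n p => φ (n + 1) (frontInsert (m + 1) p))) := by
  ext n
  cases n with
  | zero => simp [statGF, topDecreasingAv_of_lt]
  | succ n =>
    simp only [statGF, map_sub, map_add, coeff_succ_X_mul, coeff_mk, sum_topDecreasingAv_succ_sub]

/-- The generating function of `topDecreasingAv n m`. -/
noncomputable def avGF (m : ℕ) : ℚ⟦X⟧ := statGF m 1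

/-- The generating function of the total of `crossPairs j` over `topDecreasingAv n m`. -/
noncomputable def crossGF (m j : ℕ) : ℚ⟦X⟧ := statGF m fun _ p => crossPairs j p

/-- The generating function of the total number of occurrences of `213` over
`topDecreasingAv n m`. -/
noncomputable def occGF (m : ℕ) : ℚ⟦X⟧ := statGF m fun _ p => numOcc pat213 p

lemma avGF_succ_sub (m : ℕ) : avGF (m + 1) - avGF (m + 2) = X * avGF m := by
  rw [avGF, avGF, avGF, statGF_succ_sub]
  exact congrArg _ (sub_add_cancel _ _)

lemma avGF_zero : avGF 0 = avGF 1 + 1 := by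
  simp [avGF, statGF_zero]

lemma crossGF_zero_right (m : ℕ) : crossGF m 0 = 0 := by
  simp [crossGF, statGF, crossPairs_zero, PowerSeries.ext_iff]

lemma crossGF_succ_sub {j : ℕ} (hj : j ≤ m) :
    crossGF (m + 1) (j + 1) - crossGF (m + 2) (j + 1) =
      X * (crossGF m j - crossGF (m + 1) j + crossGF (m + 1) (j + 1) +
        ((j + 1 : ℕ) : ℚ⟦X⟧) * avGF (m + 1)) := by
  have insert_front : statGF (m + 1) (fun _ p => (crossPairs (j + 1) (frontInsert (m + 1) p) : ℚ)) =
      crossGF (m + 1) (j + 1) + ((j + 1 : ℕ) : ℚ⟦X⟧) * avGF (m + 1) := by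
    rw [crossGF, avGF, ← statGF_natCast, ← statGF_add]
    refine statGF_congr fun n p hp => ?_
    rw [crossPairs_frontInsert (mem_topDecreasingAv.1 hp).2.1 (Nat.succ_le_succ hj)]
    simp
  rw [crossGF, crossGF, statGF_succ_sub, insert_front]
  simp only [crossPairs_frontInsert_zero, crossGF, add_assoc]

lemma occGF_zero : occGF 0 = occGF 1 := by
  have : numOcc pat213 (1 : Equiv.Perm (Fin 0)) = 0 := by decide
  simp [occGF, statGF_zero, this]

lemma occGF_succ_sub (m : ℕ) :
    occGF (m + 1) - occGF (m + 2) = X * (occGF m + crossGF (m + 1) (m + 1)) := by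
  have insert_front : statGF (m + 1) (fun _ p => (numOcc pat213 (frontInsert (m + 1) p) : ℚ)) =
      occGF (m + 1) + crossGF (m + 1) (m + 1) := by
    rw [occGF, crossGF, ← statGF_add]
    refine statGF_congr fun n p hp => ?_
    rw [numOcc_pat213_frontInsert (mem_topDecreasingAv.1 hp).2.1]
    simp
  rw [occGF, occGF, statGF_succ_sub, insert_front]
  simp only [numOcc_pat213_frontInsert (Nat.zero_le _), crossPairs_zero, add_zero, occGF]
  ring

lemma X_pow_dvd_avGF (m : ℕ) : X ^ m ∣ avGF m := X_pow_dvd_statGF m _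

lemma X_pow_dvd_crossGF (m j : ℕ) : X ^ m ∣ crossGF m j := X_pow_dvd_statGF m _

lemma X_pow_dvd_occGF (m : ℕ) : X ^ m ∣ occGF m := X_pow_dvd_statGF m _

end Recurrences

section Solution

/-- Going down the sequence, every `f k` is divisible by all the `f N` with `k ≤ N`, hence by all
powers of `X`. -/
lemma eq_zero_of_X_pow_dvd_of_succ_dvd {R : Type*} [Semiring R] {f : ℕ → R⟦X⟧}
    (hX : ∀ k, X ^ k ∣ f k) (hf : ∀ k, f (k + 1) ∣ f k) (k : ℕ) : f k = 0 := by
  ext n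
  have hdvd : f (k + (n + 1)) ∣ f k := by
    induction n with
    | zero => exact hf k
    | succ n ih => exact (hf _).trans ih
  exact X_pow_dvd_iff.1 ((hX _).trans hdvd) n (by omega)

lemma one_sub_pow_three_mul_eq {R : Type*} [CommRing R] {f : ℕ → R⟦X⟧} {a c t : R⟦X⟧}
    (ht : X ∣ t) (hX : ∀ m, X ^ m ∣ f m)
    (hf : ∀ m, f m = a * t ^ m * ((m + 2).choose 2 : ℕ) + c * f (m + 1)) :
    (1 - c * t) ^ 3 * f 0 = a := by
  -- `P m / (1 - c * t) ^ 3` is the tail sum `∑ₗ binom(m + l + 2, 2) (c * t)ˡ`.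
  let P (m : ℕ) : R⟦X⟧ :=
    (1 - c * t) ^ 2 * ((m + 2).choose 2 : ℕ) + (1 - c * t) * (c * t) * (m + 2) + (c * t) ^ 2
  have P_eq (m : ℕ) : P m = (1 - c * t) ^ 3 * ((m + 2).choose 2 : ℕ) + c * t * P (m + 1) := by
    have pascal : ((m + 3).choose 2 : ℕ) = (m + 2) + (m + 2).choose 2 := by
      rw [Nat.choose_succ_succ', Nat.choose_one_right]
    simp only [P, add_right_comm m 1 2, pascal]
    push_cast
    ring
  have hzero := eq_zero_of_X_pow_dvd_of_succ_dvd
    (f := fun m => (1 - c * t) ^ 3 * f m - a * t ^ m * P m)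
    (fun m => dvd_sub ((hX m).mul_left _) (((pow_dvd_pow_of_dvd ht m).mul_left a).mul_right _))
    (fun m => ⟨c, by linear_combination (1 - c * t) ^ 3 * hf m - a * t ^ m * P_eq m⟩) 0
  have P_zero : P 0 = 1 := by
    simp only [P, zero_add, Nat.choose_self]
    push_cast
    ring
  linear_combination hzero + a * P_zero

lemma catalanGF_eq : catalanGF = 1 + X * catalanGF ^ 2 := by
  have map_catalanSeries : PowerSeries.map (Nat.castRingHom ℚ) catalanSeries = catalanGF := by
    ext n
    simp [catalanGF]
  have := congrArg (PowerSeries.map (Nat.castRingHom ℚ)) catalanSeries_sq_mul_X_add_one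
  simp only [map_add, map_mul, map_pow, map_one, PowerSeries.map_X, map_catalanSeries] at this
  linear_combination -this

lemma catalanGF_mul_one_sub : catalanGF * (1 - X * catalanGF) = 1 := by
  linear_combination catalanGF_eq

/-- With `E` the shift `f ↦ f (· + 1)`, the operator `E - E² - X` of the recurrences factors as
`(1 - C E) ((1 - X C) E - X)`, where `C` is the Catalan series; this is the second factor. -/
noncomputable def kernelFactor (f : ℕ → ℚ⟦X⟧) (m : ℕ) : ℚ⟦X⟧ :=
  (1 - X * catalanGF) * f (m + 1) - X * f m

lemma X_pow_dvd_kernelFactor {f : ℕ → ℚ⟦X⟧} (hX : ∀ m, X ^ m ∣ f m) (m : ℕ) :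
    X ^ m ∣ kernelFactor f m :=
  dvd_sub (((pow_dvd_pow X m.le_succ).trans (hX (m + 1))).mul_left _) ((hX m).mul_left X)

lemma kernelFactor_eq {f : ℕ → ℚ⟦X⟧} {m : ℕ} {b : ℚ⟦X⟧}
    (h : f (m + 1) - f (m + 2) = X * f m + b) :
    kernelFactor f m = b + catalanGF * kernelFactor f (m + 1) := by
  simp only [kernelFactor]
  linear_combination h - f (m + 2) * catalanGF_mul_one_sub

lemma avGF_eq (m : ℕ) : avGF m = (X * catalanGF) ^ m * catalanGF := by
  have avGF_succ (m : ℕ) : avGF (m + 1) = X * catalanGF * avGF m := by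
    have kernelFactor_zero : kernelFactor avGF m = 0 := by
      refine eq_zero_of_X_pow_dvd_of_succ_dvd (f := kernelFactor avGF)
        (X_pow_dvd_kernelFactor X_pow_dvd_avGF) (fun m => Dvd.intro_left catalanGF ?_) m
      rw [kernelFactor_eq ((avGF_succ_sub m).trans (add_zero _).symm), zero_add]
    rw [kernelFactor] at kernelFactor_zero
    linear_combination catalanGF * kernelFactor_zero - avGF (m + 1) * catalanGF_mul_one_sub
  induction m with
  | zero =>
    linear_combination catalanGF * (avGF_zero + avGF_succ 0) - avGF 0 * catalanGF_mul_one_sub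
  | succ m ih =>
    rw [avGF_succ, ih]
    ring

lemma crossGF_eq {m j : ℕ} (hj : j ≤ m) :
    crossGF m j = ((j + 1).choose 2 : ℚ⟦X⟧) * ((X * catalanGF) ^ (m + 1) * catalanGF ^ 2) := by
  induction j generalizing m with
  | zero => simp [crossGF_zero_right]
  | succ j ih =>
    obtain ⟨k, rfl⟩ := Nat.exists_eq_add_of_le' hj
    let defect (k : ℕ) : ℚ⟦X⟧ := crossGF (k + (j + 1)) (j + 1) -
      ((j + 2).choose 2 : ℚ⟦X⟧) * ((X * catalanGF) ^ (k + (j + 1) + 1) * catalanGF ^ 2)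
    have X_pow_dvd_defect (k : ℕ) : X ^ k ∣ defect k := by
      have dvd_shift (l : ℕ) : (X : ℚ⟦X⟧) ^ k ∣ X ^ (k + l) := pow_dvd_pow X (k.le_add_right l)
      refine dvd_sub ((dvd_shift _).trans (X_pow_dvd_crossGF _ _))
        (((dvd_shift (j + 1 + 1)).trans ?_).mul_right _ |>.mul_left _)
      exact pow_dvd_pow_of_dvd (dvd_mul_right X catalanGF) _
    have pascal : (j + 2).choose 2 = (j + 1) + (j + 1).choose 2 := by
      rw [Nat.choose_succ_succ', Nat.choose_one_right]
    have defect_succ (k : ℕ) : defect (k + 1) = (1 - X) * defect k := by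
      have h := crossGF_succ_sub (m := k + j) (j := j) (by omega)
      rw [ih (by omega), ih (by omega), avGF_eq] at h
      simp only [defect, pascal, ← add_assoc, add_right_comm k 1 j]
      push_cast at h ⊢
      linear_combination -h + X * (X * catalanGF) ^ (k + j + 1) *
        ((j + 1 + (j + 1).choose 2) * (catalanGF + catalanGF ^ 2) -
          (j + 1).choose 2 * catalanGF) * catalanGF_mul_one_sub
    have isUnit_one_sub_X : IsUnit (1 - X : ℚ⟦X⟧) := by
      simp [PowerSeries.isUnit_iff_constantCoeff]
    refine sub_eq_zero.1 (eq_zero_of_X_pow_dvd_of_succ_dvd X_pow_dvd_defect (fun k => ?_) k)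
    rw [defect_succ]
    exact isUnit_one_sub_X.mul_left_dvd.2 dvd_rfl

lemma occGF_zero_mul : occGF 0 * (1 - 2 * (X * catalanGF)) ^ 3 = X ^ 3 * catalanGF ^ 3 := by
  have kernel_sum : (1 - catalanGF * (X * catalanGF)) ^ 3 * kernelFactor occGF 0 =
      X * (X * catalanGF) ^ 2 * catalanGF ^ 2 := by
    refine one_sub_pow_three_mul_eq (dvd_mul_right _ _)
      (X_pow_dvd_kernelFactor X_pow_dvd_occGF) fun m => ?_
    rw [kernelFactor_eq ((occGF_succ_sub m).trans (mul_add _ _ _)), crossGF_eq le_rfl]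
    ring
  have kernel_zero : kernelFactor occGF 0 * catalanGF ^ 2 = occGF 0 := by
    simp only [kernelFactor, zero_add, ← occGF_zero]
    linear_combination occGF 0 * (catalanGF + 1) * catalanGF_mul_one_sub
  have one_sub_eq : 1 - catalanGF * (X * catalanGF) = catalanGF * (1 - 2 * (X * catalanGF)) := by
    linear_combination -catalanGF_mul_one_sub
  rw [one_sub_eq] at kernel_sum
  linear_combination (1 - X * catalanGF) *
      (kernel_sum - catalanGF * (1 - 2 * (X * catalanGF)) ^ 3 * kernel_zero) -
    (occGF 0 * (1 - 2 * (X * catalanGF)) ^ 3 - X ^ 3 * catalanGF ^ 3) * catalanGF_mul_one_sub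

lemma oneSubFourXPow_add (r s : ℚ) :
    oneSubFourXPow (r + s) = oneSubFourXPow r * oneSubFourXPow s := by
  simp [oneSubFourXPow]

lemma constantCoeff_oneSubFourXPow (r : ℚ) : constantCoeff (oneSubFourXPow r) = 1 := by
  rw [← coeff_zero_eq_constantCoeff_apply, oneSubFourXPow, coeff_rescale]
  simp

lemma oneSubFourXPow_one : oneSubFourXPow 1 = 1 - 4 * X := by
  have h := binomialSeries_nat (R := ℚ) (A := ℚ) 1
  rw [Nat.cast_one, pow_one] at h
  rw [oneSubFourXPow, h, map_add, map_one, rescale_X, map_neg, map_ofNat]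
  ring

lemma one_sub_four_mul_X_eq : 1 - 4 * X = (1 - 2 * (X * catalanGF)) ^ 2 := by
  linear_combination 4 * X * catalanGF_eq

lemma oneSubFourXPow_half : oneSubFourXPow (1 / 2) = 1 - 2 * (X * catalanGF) := by
  have squares_eq : oneSubFourXPow (1 / 2) ^ 2 = (1 - 2 * (X * catalanGF)) ^ 2 := by
    rw [sq, ← oneSubFourXPow_add, add_halves, oneSubFourXPow_one, one_sub_four_mul_X_eq]
  refine (sq_eq_sq_iff_eq_or_eq_neg.1 squares_eq).resolve_right fun h => ?_
  have := congrArg constantCoeff h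
  norm_num [constantCoeff_oneSubFourXPow] at this

lemma oneSubFourXPow_three_halves :
    oneSubFourXPow (3 / 2) = (1 - 2 * (X * catalanGF)) ^ 3 := by
  rw [show (3 / 2 : ℚ) = 1 / 2 + 1 / 2 + 1 / 2 by norm_num, oneSubFourXPow_add,
    oneSubFourXPow_add, oneSubFourXPow_half]
  ring

lemma X_pow_three_mul_catalanGF_pow_three_mul_inv :
    X ^ 3 * catalanGF ^ 3 * (oneSubFourXPow (3 / 2))⁻¹ =
      (X - 1) * (2 * (1 - 4 * X))⁻¹ - (3 * X - 1) * (2 * oneSubFourXPow (3 / 2))⁻¹ := by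
  rw [one_sub_four_mul_X_eq, oneSubFourXPow_three_halves]
  set w := 1 - 2 * (X * catalanGF) with hw
  have two_mul_inv : 2 * w ^ 3 * (2 * w ^ 3)⁻¹ = 1 :=
    PowerSeries.mul_inv_cancel _ (by simp [hw, map_ofNat constantCoeff 2])
  have inv_cube : (w ^ 3)⁻¹ = 2 * (2 * w ^ 3)⁻¹ := by
    rw [PowerSeries.inv_eq_iff_mul_eq_one (by simp [hw, map_ofNat constantCoeff 2])]
    linear_combination two_mul_inv
  have inv_two_mul_sq : (2 * w ^ 2)⁻¹ = w * (2 * w ^ 3)⁻¹ := by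
    rw [PowerSeries.inv_eq_iff_mul_eq_one (by simp [hw, map_ofNat constantCoeff 2])]
    linear_combination two_mul_inv
  have numerators : 2 * (X ^ 3 * catalanGF ^ 3) = (X - 1) * w - (3 * X - 1) := by
    linear_combination (X - 1) * hw - 2 * X * (1 + X * catalanGF) * catalanGF_eq
  rw [inv_cube, inv_two_mul_sq]
  linear_combination (2 * w ^ 3)⁻¹ * numerators

end Solution

theorem mainTheorem1 :
    (PowerSeries.mk fun n => (totalOcc pat213 (Av n pat123) : ℚ)) =
        X ^ 3 * catalanGF ^ 3 * (oneSubFourXPow (3 / 2))⁻¹ ∧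
      X ^ 3 * catalanGF ^ 3 * (oneSubFourXPow (3 / 2))⁻¹ =
        (X - 1) * (2 * (1 - 4 * X))⁻¹ - (3 * X - 1) * (2 * oneSubFourXPow (3 / 2))⁻¹ := by
  refine ⟨?_, X_pow_three_mul_catalanGF_pow_three_mul_inv⟩
  have totalOcc_eq : (PowerSeries.mk fun n => (totalOcc pat213 (Av n pat123) : ℚ)) = occGF 0 := by
    simp only [occGF, statGF, totalOcc, topDecreasingAv_zero, Nat.cast_sum]
  rw [totalOcc_eq, eq_mul_inv_iff_mul_eq (by simp [constantCoeff_oneSubFourXPow]),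
    oneSubFourXPow_three_halves, occGF_zero_mul]
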